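/- Let $H$ be an infinite-dimensional complex Hilbert space and let $T$ be a bounded positive operator on $H$ (that is, $T=T^*$ and $\langle Tx,x\rangle\ge 0$ for all $x\in H$). Call a bounded operator $S$ from a nonzero Hilbert space $M$ to $H$ minimum attaining if there is a unit vector $x\in M$ with $\|Sx\|=m(S):=\inf\{\|Sy\| : y\in M,\ \|y\|=1\}$, and call $T$ absolutely minimum attaining if $T|_M\colon M\to H$ is minimum attaining for every nonzero closed subspace $M$ of $H$. Let $\sigma_{ess}(T)=\sigma(T)\setminus\sigma_d(T)$, where $\sigma_d(T)$ is the set of eigenvalues of $T$ of finite multiplicity that are isolated points of the spectrum $\sigma(T)$, and let $m_e(T)=\inf\{|\lambda| : \lambda\in\sigma_{ess}(T)\}$. Then $T$ is absolutely minimum attaining if and only if both of the following hold: 1. $\sigma_{ess}(T)$ consists of exactly one point; 2. the interval $(m_e(T),\|T\|]$ contains only finitely many eigenvalues of $T$. -/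

import Mathlib

open Set Filter Topology

noncomputable section

/-- The minimum modulus `m(T) = inf {‖T x‖ : ‖x‖ = 1}`. -/
def minimumModulus {E F : Type*} [NormedAddCommGroup E] [NormedSpace ℂ E]
    [NormedAddCommGroup F] [NormedSpace ℂ F] (T : E →L[ℂ] F) : ℝ :=
  sInf {r : ℝ | ∃ x : E, ‖x‖ = 1 ∧ r = ‖T x‖}

/-- `T` is minimum attaining if `‖T x‖ = m(T)` for some unit vector `x`. -/
def IsMinimumAttaining {E F : Type*} [NormedAddCommGroup E] [NormedSpace ℂ E]
    [NormedAddCommGroup F] [NormedSpace ℂ F] (T : E →L[ℂ] F) : Prop :=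
  ∃ x : E, ‖x‖ = 1 ∧ ‖T x‖ = minimumModulus T

/-- `T` is absolutely minimum attaining if its restriction to every closed subspace is minimum
attaining. The zero subspace has no unit vector and is left out. -/
def IsAbsolutelyMinimumAttaining {E F : Type*} [NormedAddCommGroup E] [NormedSpace ℂ E]
    [NormedAddCommGroup F] [NormedSpace ℂ F] (T : E →L[ℂ] F) : Prop :=
  ∀ M : Submodule ℂ E, IsClosed (M : Set E) → M ≠ ⊥ → IsMinimumAttaining (T.comp M.subtypeL)

/-- The discrete spectrum of a self-adjoint operator: the eigenvalues of finite multiplicity that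
are isolated points of the spectrum. -/
def discreteSpectrum {H : Type*} [NormedAddCommGroup H] [InnerProductSpace ℂ H]
    (T : H →L[ℂ] H) : Set ℂ :=
  {z : ℂ | Module.End.HasEigenvalue (T : H →ₗ[ℂ] H) z ∧
    FiniteDimensional ℂ (Module.End.eigenspace (T : H →ₗ[ℂ] H) z) ∧
    ¬ AccPt z (𝓟 (spectrum ℂ T))}

/-- The essential spectrum of a self-adjoint operator: the complement of the discrete spectrum
in the spectrum. -/
def essentialSpectrum {H : Type*} [NormedAddCommGroup H] [InnerProductSpace ℂ H]
    (T : H →L[ℂ] H) : Set ℂ :=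
  spectrum ℂ T \ discreteSpectrum T

/-- The essential minimum modulus `m_e(T) = inf {|z| : z ∈ σ_ess(T)}` of a self-adjoint
operator. -/
def essentialMinimumModulus {H : Type*} [NormedAddCommGroup H] [InnerProductSpace ℂ H]
    (T : H →L[ℂ] H) : ℝ :=
  sInf ((fun z : ℂ => ‖z‖) '' essentialSpectrum T)

end

/-! Minimum attainment fails on the closed span of an orthonormal family whose images are orthogonal
with norms that approach some `c` without reaching it: by Parseval every unit vector of the span has
image of norm above `c`. Necessity of both conditions comes from such families. If the essential
spectrum contains `a < b`, fix `c` between them. Both points are approximate eigenvalues on every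
subspace of finite codimension, and the unit sphere there is connected, so `‖T z‖` takes every value
in `(c, b)` with `z` orthogonal to any given finite set; an inductive choice gives the family. If
infinitely many eigenvalues exceed the only essential point `b`, they accumulate at `b`, and their
eigenvectors form the family.

For sufficiency, let `σ_ess(T) = {b}`, let `M` be infinite-dimensional and let `m` be the minimum
modulus of `T` on `M`. The operator `T ^ 2 - b ^ 2` is compact, because its symbol vanishes on the
essential spectrum. If `m < b`, the nonzero number `m ^ 2 - b ^ 2` must be an eigenvalue of its
compression to `M`, and an eigenvector attains `m`. If `m ≥ b`, the positive part of `T ^ 2 - b ^ 2`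
has finite rank by the second condition, so `M` meets its kernel in some `x ≠ 0`, and `‖T x‖ ≤ b *
‖x‖ ≤ m * ‖x‖`. -/

/-! ### Orthonormal families that prevent attainment -/

theorem norm_inv_norm_smul {E : Type*} [NormedAddCommGroup E] [NormedSpace ℂ E] {x : E}
    (hx : x ≠ 0) : ‖((‖x‖⁻¹ : ℝ) : ℂ) • x‖ = 1 := by
  rw [norm_smul, Complex.norm_real, norm_inv, norm_norm, inv_mul_cancel₀ (norm_ne_zero_iff.2 hx)]

theorem minimumModulus_le {E F : Type*} [NormedAddCommGroup E] [NormedSpace ℂ E]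
    [NormedAddCommGroup F] [NormedSpace ℂ F] (T : E →L[ℂ] F) {x : E} (hx : ‖x‖ = 1) :
    minimumModulus T ≤ ‖T x‖ :=
  csInf_le ⟨0, by rintro _ ⟨y, -, rfl⟩; exact norm_nonneg _⟩ ⟨x, hx, rfl⟩

/-- Orthogonality of the images gives a Parseval formula for `‖S x‖ ^ 2`, compared termwise with the
one for `‖x‖ ^ 2`. The inequality is strict because some coefficient of `x` is nonzero. -/
theorem HilbertBasis.mul_norm_lt_norm_apply {ι E F : Type*} [NormedAddCommGroup E]
    [InnerProductSpace ℂ E] [NormedAddCommGroup F] [InnerProductSpace ℂ F]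
    (e : HilbertBasis ι ℂ E) (S : E →L[ℂ] F)
    (horth : Pairwise fun i j => inner ℂ (S (e i)) (S (e j)) = 0) {c : ℝ} (hc : 0 ≤ c)
    (hlt : ∀ i, c < ‖S (e i)‖) {x : E} (hx : x ≠ 0) : c * ‖x‖ < ‖S x‖ := by
  have hS : HasSum (fun i => e.repr x i • S (e i)) (S x) := by
    simpa using (e.hasSum_repr x).mapL S
  have hcoef (i : ι) : inner ℂ (S (e i)) (S x) = e.repr x i * ((‖S (e i)‖ ^ 2 : ℝ) : ℂ) := by
    have h1 := hS.mapL (innerSL ℂ (S (e i)))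
    refine h1.unique ?_
    convert hasSum_single i ?_ using 1
    · simp [inner_self_eq_norm_sq_to_K]
    · intro j hj
      simp [horth hj.symm]
  have hnormS : HasSum (fun i => ‖e.repr x i‖ ^ 2 * ‖S (e i)‖ ^ 2) (‖S x‖ ^ 2) := by
    have h1 := (hS.mapL (innerSL ℂ (S x))).mapL Complex.reCLM
    convert h1 using 1
    · ext i
      have : inner ℂ (S x) (S (e i)) =
          (starRingEnd ℂ) (e.repr x i) * ((‖S (e i)‖ ^ 2 : ℝ) : ℂ) := by
        rw [← inner_conj_symm, hcoef, map_mul, Complex.conj_ofReal]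
      simp only [innerSL_apply_apply, inner_smul_right, this, Complex.reCLM_apply]
      rw [← mul_assoc, Complex.mul_conj, Complex.normSq_eq_norm_sq, ← Complex.ofReal_mul,
        Complex.ofReal_re]
    · simp only [innerSL_apply_apply, Complex.reCLM_apply]
      exact (inner_self_eq_norm_sq (𝕜 := ℂ) (S x)).symm
  have hnorm : HasSum (fun i => ‖e.repr x i‖ ^ 2) (‖x‖ ^ 2) := by
    have h1 := (e.hasSum_inner_mul_inner x x).mapL Complex.reCLM
    convert h1 using 1
    · ext i
      rw [e.repr_apply_apply, ← inner_conj_symm x (e i), mul_comm, Complex.mul_conj,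
        Complex.normSq_eq_norm_sq, Complex.reCLM_apply, Complex.ofReal_re]
    · exact (inner_self_eq_norm_sq (𝕜 := ℂ) x).symm
  obtain ⟨i, hi⟩ : ∃ i, e.repr x i ≠ 0 := by
    by_contra! h
    exact hx (e.repr.map_eq_zero_iff.1 (by ext i; simpa using h i))
  have hmono (j : ι) : c ^ 2 ≤ ‖S (e j)‖ ^ 2 := pow_le_pow_left₀ hc (hlt j).le 2
  have key : c ^ 2 * ‖x‖ ^ 2 < ‖S x‖ ^ 2 := by
    refine hasSum_lt (i := i) (fun j => ?_) ?_ (hnorm.mul_left (c ^ 2)) hnormS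
    · simp only
      rw [mul_comm]
      exact mul_le_mul_of_nonneg_left (hmono j) (by positivity)
    · simp only
      rw [mul_comm]
      exact mul_lt_mul_of_pos_left (pow_lt_pow_left₀ (hlt i) hc two_ne_zero) (by positivity)
  rw [← mul_pow] at key
  exact lt_of_pow_lt_pow_left₀ 2 (norm_nonneg _) key

/-- On the closed span of an orthonormal family with orthogonal images whose norms approach their
infimum without reaching it, the minimum modulus is not attained. -/
theorem not_isAbsolutelyMinimumAttaining_of_orthonormal {ι E F : Type*} [Nonempty ι]
    [NormedAddCommGroup E] [InnerProductSpace ℂ E] [CompleteSpace E]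
    [NormedAddCommGroup F] [InnerProductSpace ℂ F] (T : E →L[ℂ] F) {z : ι → E}
    (hz : Orthonormal ℂ z) (horth : Pairwise fun i j => inner ℂ (T (z i)) (T (z j)) = 0)
    {c : ℝ} (hc : 0 ≤ c) (hlt : ∀ i, c < ‖T (z i)‖)
    (hinf : ∀ d, c < d → ∃ i, ‖T (z i)‖ < d) : ¬ IsAbsolutelyMinimumAttaining T := by
  intro hT
  set M := (Submodule.span ℂ (range z)).topologicalClosure with hM
  have hzM (i : ι) : z i ∈ M :=
    Submodule.le_topologicalClosure _ (Submodule.subset_span (mem_range_self i))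
  have hMc : IsClosed (M : Set E) := Submodule.isClosed_topologicalClosure _
  have : CompleteSpace M := hMc.completeSpace_coe
  let w (i : ι) : M := ⟨z i, hzM i⟩
  have hw : Orthonormal ℂ w := ⟨hz.1, fun _ _ hij => hz.2 hij⟩
  have hspan : (Submodule.span ℂ (range w))ᗮ = ⊥ := by
    rw [Submodule.eq_bot_iff]
    intro x hx
    have h1 : (x : E) ∈ (Submodule.span ℂ (range z))ᗮ := by
      rw [Submodule.mem_orthogonal] at hx ⊢
      intro u hu
      induction hu using Submodule.span_induction with
      | mem u hu =>
        obtain ⟨i, rfl⟩ := hu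
        exact hx (w i) (Submodule.subset_span (mem_range_self i))
      | zero => simp
      | add u v _ _ hu hv => rw [inner_add_left, hu, hv, add_zero]
      | smul a u _ hu => rw [inner_smul_left, hu, mul_zero]
    rw [← Submodule.orthogonal_closure] at h1
    have := (Submodule.mem_orthogonal _ _).1 h1 x x.2
    exact Subtype.ext (inner_self_eq_zero.1 this)
  let e := HilbertBasis.mkOfOrthogonalEqBot hw hspan
  have he (i : ι) : (T.comp M.subtypeL) (e i) = T (z i) := by
    simp [e, w]
  obtain ⟨i₀⟩ := ‹Nonempty ι›
  have hne : M ≠ ⊥ := by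
    rw [Submodule.ne_bot_iff]
    exact ⟨z i₀, hzM i₀, hz.ne_zero i₀⟩
  obtain ⟨x, hx, hmin⟩ := hT M hMc hne
  have h1 : c < ‖(T.comp M.subtypeL) x‖ := by
    simpa [hx] using e.mul_norm_lt_norm_apply (T.comp M.subtypeL)
      (fun i j hij => by simpa only [he] using horth hij) hc (fun i => by rw [he]; exact hlt i)
      (x := x) (by rintro rfl; simp at hx)
  obtain ⟨i, hi⟩ := hinf _ h1
  have h2 := minimumModulus_le (T.comp M.subtypeL) (x := w i) (hz.1 i)
  rw [← hmin] at h2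
  exact absurd hi (not_lt.2 h2)

/-! ### Essential spectrum and approximate eigenvectors -/

theorem IsSelfAdjoint.isUnit_of_mul_norm_le {H : Type*} [NormedAddCommGroup H]
    [InnerProductSpace ℂ H] [CompleteSpace H] {A : H →L[ℂ] H} (hA : IsSelfAdjoint A) {c : ℝ}
    (hc : 0 < c) (h : ∀ x, c * ‖x‖ ≤ ‖A x‖) : IsUnit A := by
  have hK : ∃ K, AntilipschitzWith K A := by
    rw [antilipschitzWith_iff_exists_mul_le_norm]
    exact ⟨c, hc, h⟩
  rw [ContinuousLinearMap.isUnit_iff_bijective,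
    ContinuousLinearMap.bijective_iff_dense_range_and_antilipschitz]
  refine ⟨?_, hK⟩
  rw [Submodule.topologicalClosure_eq_top_iff, A.orthogonal_range, hA.adjoint_eq,
    LinearMap.ker_eq_bot]
  obtain ⟨K, hK⟩ := hK
  exact hK.injective

/-- An operator bounded below on a subspace of finite codimension has finite-dimensional kernel. -/
theorem finiteDimensional_ker_of_mul_norm_le {H F : Type*} [NormedAddCommGroup H]
    [InnerProductSpace ℂ H] [NormedAddCommGroup F] [NormedSpace ℂ F]
    (A : H →L[ℂ] F) (V : Submodule ℂ H) [FiniteDimensional ℂ V] {c : ℝ} (hc : 0 < c)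
    (h : ∀ x ∈ Vᗮ, c * ‖x‖ ≤ ‖A x‖) : FiniteDimensional ℂ A.ker := by
  refine FiniteDimensional.of_injective
    ((V.orthogonalProjectionOnto : H →ₗ[ℂ] V).comp A.ker.subtype) ?_
  rw [← LinearMap.ker_eq_bot, Submodule.eq_bot_iff]
  rintro ⟨x, hx⟩ hx'
  have hxV : x ∈ Vᗮ := by
    rw [← Submodule.orthogonalProjectionOnto_eq_zero_iff]
    simpa using hx'
  have h1 := h x hxV
  rw [show A x = 0 from hx, norm_zero] at h1
  have : ‖x‖ = 0 := by nlinarith [norm_nonneg x]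
  simpa using this

/-- An operator bounded below on a subspace of finite codimension is bounded below on the
orthogonal complement of its kernel. -/
theorem exists_mul_norm_le_of_mem_orthogonal_ker {H F : Type*} [NormedAddCommGroup H]
    [InnerProductSpace ℂ H] [CompleteSpace H] [NormedAddCommGroup F] [NormedSpace ℂ F]
    [CompleteSpace F] (A : H →L[ℂ] F) (V : Submodule ℂ H) [FiniteDimensional ℂ V] {c : ℝ}
    (hc : 0 < c) (h : ∀ x ∈ Vᗮ, c * ‖x‖ ≤ ‖A x‖) :
    ∃ δ > 0, ∀ x ∈ A.kerᗮ, δ * ‖x‖ ≤ ‖A x‖ := by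
  have : FiniteDimensional ℂ A.ker := finiteDimensional_ker_of_mul_norm_le A V hc h
  have hmap : IsClosed ((Vᗮ.map (A : H →ₗ[ℂ] F) : Submodule ℂ F) : Set F) := by
    have hK : ∃ K, AntilipschitzWith K (A.comp Vᗮ.subtypeL) := by
      rw [antilipschitzWith_iff_exists_mul_le_norm]
      exact ⟨c, hc, fun x => h x x.2⟩
    obtain ⟨K, hK⟩ := hK
    convert hK.isClosed_range (A.comp Vᗮ.subtypeL).uniformContinuous using 1
    ext y
    simp
  -- The range is the closed image of `Vᗮ` plus the finite-dimensional image of `V`.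
  have hrange : IsClosed (A.range : Set F) := by
    have h1 := Submodule.isClosed_sup_finiteDimensional _ (V.map (A : H →ₗ[ℂ] F)) hmap
    rwa [← Submodule.map_sup, sup_comm, Submodule.sup_orthogonal_of_hasOrthogonalProjection,
      Submodule.map_top] at h1
  have hinj : Function.Injective (A.comp A.kerᗮ.subtypeL) := by
    rw [injective_iff_map_eq_zero]
    rintro ⟨x, hx⟩ hx'
    have : x ∈ A.ker ⊓ A.kerᗮ := ⟨hx', hx⟩
    rw [Submodule.inf_orthogonal_eq_bot] at this
    exact Subtype.ext this
  have hcl : IsClosed (range (A.comp A.kerᗮ.subtypeL)) := by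
    convert hrange using 1
    ext y
    constructor
    · rintro ⟨x, rfl⟩
      exact ⟨x, rfl⟩
    · rintro ⟨x, rfl⟩
      obtain ⟨n, hn, m, hm, rfl⟩ := A.ker.exists_add_mem_mem_orthogonal x
      exact ⟨⟨m, hm⟩, by simp [show A n = 0 from hn]⟩
  obtain ⟨δ, hδ, h1⟩ := antilipschitzWith_iff_exists_mul_le_norm.1
    ((A.comp A.kerᗮ.subtypeL).antilipschitz_of_injective_of_isClosed_range hinj hcl)
  exact ⟨δ, hδ, fun x hx => h1 ⟨x, hx⟩⟩

/-- The kernel and its complement are both invariant under `A`. The shifted operator is `-ν` on the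
first and bounded below by `δ - |ν|` on the second, so Pythagoras bounds it below. Hence 0 is at
most an isolated point of the spectrum of `A`. -/
theorem IsSelfAdjoint.isUnit_sub_smul_one {H : Type*} [NormedAddCommGroup H]
    [InnerProductSpace ℂ H] [CompleteSpace H] {A : H →L[ℂ] H} (hA : IsSelfAdjoint A) {δ ν : ℝ}
    (h : ∀ x ∈ A.kerᗮ, δ * ‖x‖ ≤ ‖A x‖) (hν : ν ≠ 0) (hνδ : |ν| < δ) :
    IsUnit (A - (ν : ℂ) • (1 : H →L[ℂ] H)) := by
  have hsa : IsSelfAdjoint (A - (ν : ℂ) • (1 : H →L[ℂ] H)) :=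
    hA.sub (IsSelfAdjoint.smul (Complex.conj_ofReal ν) (IsSelfAdjoint.one _))
  have : CompleteSpace A.ker := A.isClosed_ker.completeSpace_coe
  have hν' : 0 < |ν| := abs_pos.2 hν
  have hc : 0 < min |ν| (δ - |ν|) := lt_min hν' (by linarith)
  refine hsa.isUnit_of_mul_norm_le hc fun x => ?_
  obtain ⟨n, hn, m, hm, rfl⟩ := A.ker.exists_add_mem_mem_orthogonal x
  set c := min |ν| (δ - |ν|)
  have hAn : A n = 0 := hn
  have hAm : A m ∈ A.kerᗮ := by
    rw [Submodule.mem_orthogonal]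
    intro u hu
    have hu' : A u = 0 := hu
    rw [← ContinuousLinearMap.adjoint_inner_left, hA.adjoint_eq, hu', inner_zero_left]
  have hdec : (A - (ν : ℂ) • (1 : H →L[ℂ] H)) (n + m) =
      (-(ν : ℂ)) • n + (A m - (ν : ℂ) • m) := by
    simp [hAn]
    abel
  have ho1 : inner ℂ n m = 0 := (Submodule.mem_orthogonal _ _).1 hm n hn
  have ho2 : inner ℂ ((-(ν : ℂ)) • n) (A m - (ν : ℂ) • m) = 0 :=
    (Submodule.mem_orthogonal _ _).1 (sub_mem hAm (Submodule.smul_mem _ _ hm)) _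
      (Submodule.smul_mem _ _ hn)
  have hp1 := norm_add_sq_eq_norm_sq_add_norm_sq_of_inner_eq_zero n m ho1
  have hp2 := norm_add_sq_eq_norm_sq_add_norm_sq_of_inner_eq_zero _ _ ho2
  have h1 : c * ‖n‖ ≤ ‖(-(ν : ℂ)) • n‖ := by
    rw [norm_smul, norm_neg, Complex.norm_real, Real.norm_eq_abs]
    exact mul_le_mul_of_nonneg_right (min_le_left _ _) (norm_nonneg _)
  have h2 : c * ‖m‖ ≤ ‖A m - (ν : ℂ) • m‖ := by
    have h3 := norm_sub_norm_le (A m) ((ν : ℂ) • m)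
    rw [norm_smul, Complex.norm_real, Real.norm_eq_abs] at h3
    have h4 : c * ‖m‖ ≤ (δ - |ν|) * ‖m‖ :=
      mul_le_mul_of_nonneg_right (min_le_right _ _) (norm_nonneg _)
    linarith [h m hm]
  rw [hdec]
  refine le_of_sq_le_sq ?_ (norm_nonneg _)
  have h1' := mul_self_le_mul_self (by positivity) h1
  have h2' := mul_self_le_mul_self (by positivity) h2
  calc (c * ‖n + m‖) ^ 2 = c ^ 2 * (‖n + m‖ * ‖n + m‖) := by ring
    _ = c * ‖n‖ * (c * ‖n‖) + c * ‖m‖ * (c * ‖m‖) := by rw [hp1]; ring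
    _ ≤ _ := add_le_add h1' h2'
    _ = _ := by rw [← hp2, sq]

/-- Points of the essential spectrum are approximate eigenvalues on every subspace of finite
codimension. -/
theorem IsSelfAdjoint.exists_norm_sub_smul_lt_of_mem_essentialSpectrum {H : Type*}
    [NormedAddCommGroup H] [InnerProductSpace ℂ H] [CompleteSpace H] {T : H →L[ℂ] H}
    (hT : IsSelfAdjoint T) {a : ℝ} (ha : (a : ℂ) ∈ essentialSpectrum T) (V : Submodule ℂ H)
    [FiniteDimensional ℂ V] {ε : ℝ} (hε : 0 < ε) :
    ∃ x ∈ Vᗮ, ‖x‖ = 1 ∧ ‖T x - (a : ℂ) • x‖ < ε := by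
  by_contra! hcon
  set A := T - (a : ℂ) • (1 : H →L[ℂ] H) with hAdef
  have hA : IsSelfAdjoint A :=
    hT.sub (IsSelfAdjoint.smul (Complex.conj_ofReal a) (IsSelfAdjoint.one _))
  have hbelow (x : H) (hx : x ∈ Vᗮ) : ε * ‖x‖ ≤ ‖A x‖ := by
    rcases eq_or_ne x 0 with rfl | hx0
    · simp
    have hx1 : 0 < ‖x‖ := norm_pos_iff.2 hx0
    have h1 := hcon (((‖x‖⁻¹ : ℝ) : ℂ) • x) (Submodule.smul_mem _ _ hx)
      (norm_inv_norm_smul hx0)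
    rw [map_smul, smul_comm, ← smul_sub, norm_smul, Complex.norm_real, Real.norm_eq_abs,
      abs_of_pos (inv_pos.2 hx1), ← div_eq_inv_mul, le_div_iff₀ hx1] at h1
    simpa [hAdef] using h1
  obtain ⟨δ, hδ, hker⟩ := exists_mul_norm_le_of_mem_orthogonal_ker A V hε hbelow
  have hfin := finiteDimensional_ker_of_mul_norm_le A V hε hbelow
  have hAker : Module.End.eigenspace (T : H →ₗ[ℂ] H) (a : ℂ) = A.ker := by
    ext x
    simp [hAdef, sub_eq_zero]
  have hres (μ : ℂ) : IsUnit (T - μ • (1 : H →L[ℂ] H)) → μ ∉ spectrum ℂ T := by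
    intro h
    rw [spectrum.notMem_iff, IsUnit.sub_iff, Algebra.algebraMap_eq_smul_one]
    exact h
  -- A lower bound on `Vᗮ` would make `a` an isolated eigenvalue of finite multiplicity.
  refine ha.2 ⟨?_, ?_, ?_⟩
  · rw [Module.End.hasEigenvalue_iff, hAker]
    intro hbot
    refine hres _ (hA.isUnit_of_mul_norm_le hδ fun x => hker x ?_) ha.1
    rw [hbot, Submodule.bot_orthogonal_eq_top]
    trivial
  · rwa [hAker]
  · rw [accPt_iff_nhds]
    intro hacc
    obtain ⟨μ, ⟨hμ1, hμ2⟩, hμ3⟩ := hacc _ (Metric.ball_mem_nhds _ hδ)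
    have hre : μ = (μ.re : ℂ) := hT.mem_spectrum_eq_re hμ2
    refine hres μ ?_ hμ2
    have h1 := hA.isUnit_sub_smul_one (ν := μ.re - a) hker
      (fun h0 => hμ3 (by rw [hre, sub_eq_zero.1 h0])) (by
        rw [Metric.mem_ball, dist_eq_norm, hre, ← Complex.ofReal_sub, Complex.norm_real] at hμ1
        exact hμ1)
    convert h1 using 1
    rw [hAdef, sub_sub, ← add_smul, Complex.ofReal_sub, add_sub_cancel, ← hre]

/-! ### Two essential points exclude absolute minimum attainment -/

theorem Submodule.not_finiteDimensional_orthogonal {H : Type*} [NormedAddCommGroup H]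
    [InnerProductSpace ℂ H] (hH : ¬ FiniteDimensional ℂ H) (V : Submodule ℂ H)
    [FiniteDimensional ℂ V] : ¬ FiniteDimensional ℂ Vᗮ := by
  intro h
  have h1 : FiniteDimensional ℂ (V ⊔ Vᗮ : Submodule ℂ H) := inferInstance
  rw [Submodule.sup_orthogonal_of_hasOrthogonalProjection] at h1
  exact hH (Module.finite_def.2 ((Submodule.fg_iff_finiteDimensional _).2 h1))

theorem exists_norm_apply_eq_of_mem_essentialSpectrum {H : Type*} [NormedAddCommGroup H]
    [InnerProductSpace ℂ H] [CompleteSpace H] (hH : ¬ FiniteDimensional ℂ H) {T : H →L[ℂ] H}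
    (hT : IsSelfAdjoint T) {a b d : ℝ} (ha0 : 0 ≤ a) (had : a < d) (hdb : d < b)
    (ha : (a : ℂ) ∈ essentialSpectrum T) (hb : (b : ℂ) ∈ essentialSpectrum T)
    (V : Submodule ℂ H) [FiniteDimensional ℂ V] : ∃ z ∈ Vᗮ, ‖z‖ = 1 ∧ ‖T z‖ = d := by
  -- The tolerances `d - a` and `b - d` force `‖T x‖ ≤ d ≤ ‖T y‖`; connectedness of the sphere then
  -- yields the value `d`.
  obtain ⟨x, hxV, hx1, hx⟩ :=
    hT.exists_norm_sub_smul_lt_of_mem_essentialSpectrum ha V (sub_pos.2 had)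
  obtain ⟨y, hyV, hy1, hy⟩ :=
    hT.exists_norm_sub_smul_lt_of_mem_essentialSpectrum hb V (sub_pos.2 hdb)
  have hxd : ‖T x‖ ≤ d := by
    have h1 := norm_sub_norm_le (T x) ((a : ℂ) • x)
    rw [norm_smul, hx1, Complex.norm_real, Real.norm_eq_abs, abs_of_nonneg ha0] at h1
    linarith
  have hyd : d ≤ ‖T y‖ := by
    have h1 := norm_sub_norm_le ((b : ℂ) • y) (T y)
    rw [norm_smul, hy1, Complex.norm_real, Real.norm_eq_abs, abs_of_nonneg (by linarith),
      norm_sub_rev] at h1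
    linarith
  have hrank : 1 < Module.rank ℝ Vᗮ := by
    refine lt_of_lt_of_le Cardinal.one_lt_aleph0 ?_
    rw [← not_lt, Module.rank_lt_aleph0_iff]
    intro h
    exact Submodule.not_finiteDimensional_orthogonal hH V
      (Module.Finite.of_restrictScalars_finite ℝ ℂ _)
  obtain ⟨z, hz, hzd⟩ := (isPreconnected_sphere hrank (0 : Vᗮ) 1).intermediate_value
    (a := ⟨x, hxV⟩) (b := ⟨y, hyV⟩) (by simpa using hx1) (by simpa using hy1)
    (f := fun z : Vᗮ => ‖T z‖) (by fun_prop) ⟨hxd, hyd⟩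
  exact ⟨z, z.2, by simpa using hz, hzd⟩

theorem not_isAbsolutelyMinimumAttaining_of_lt {H : Type*} [NormedAddCommGroup H]
    [InnerProductSpace ℂ H] [CompleteSpace H] (hH : ¬ FiniteDimensional ℂ H) {T : H →L[ℂ] H}
    (hT : IsSelfAdjoint T) {a b : ℝ} (ha0 : 0 ≤ a) (hab : a < b)
    (ha : (a : ℂ) ∈ essentialSpectrum T) (hb : (b : ℂ) ∈ essentialSpectrum T) :
    ¬ IsAbsolutelyMinimumAttaining T := by
  obtain ⟨c, hac, hcb⟩ := exists_between hab
  have hstep (s : Finset H) (hs : ∀ x ∈ s, ‖x‖ = 1 ∧ c < ‖T x‖) :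
      ∃ y, (‖y‖ = 1 ∧ c < ‖T y‖) ∧ ∀ x ∈ s, inner ℂ x y = 0 ∧ inner ℂ (T x) (T y) = 0 ∧
        ‖T y‖ - c ≤ (‖T x‖ - c) / 2 := by
    classical
    -- Halving the distance to `c` at each choice makes the norms converge to `c`.
    have hev : ∀ᶠ d in 𝓝[>] c, c < d ∧ d < b ∧ ∀ x ∈ s, d - c ≤ (‖T x‖ - c) / 2 := by
      refine (eventually_mem_nhdsWithin).and
        ((eventually_nhdsWithin_of_eventually_nhds (eventually_lt_nhds hcb)).and ?_)
      rw [Filter.eventually_all_finset]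
      intro x hx
      have h1 : c < c + (‖T x‖ - c) / 2 := by linarith [(hs x hx).2]
      filter_upwards [eventually_nhdsWithin_of_eventually_nhds (eventually_lt_nhds h1)] with d hd
      linarith
    obtain ⟨d, hcd, hdb, hd⟩ := hev.exists
    -- Orthogonality to `T (T x)` makes `T y` orthogonal to `T x`, since `T` is self-adjoint.
    let t : Finset H := s ∪ s.image fun x => T (T x)
    obtain ⟨y, hyV, hy1, hyd⟩ := exists_norm_apply_eq_of_mem_essentialSpectrum hH hT ha0
      (hac.trans hcd) hdb ha hb (Submodule.span ℂ (t : Set H))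
    have hort (u : H) (hu : u ∈ t) : inner ℂ u y = 0 :=
      (Submodule.mem_orthogonal _ _).1 hyV u (Submodule.subset_span hu)
    refine ⟨y, ⟨hy1, hyd ▸ hcd⟩, fun x hx => ⟨hort x (by simp [t, hx]), ?_, hyd ▸ hd x hx⟩⟩
    rw [← ContinuousLinearMap.adjoint_inner_left, hT.adjoint_eq]
    exact hort _ (Finset.mem_union_right _ (Finset.mem_image_of_mem _ hx))
  obtain ⟨f, hf, hr⟩ := exists_seq_of_forall_finset_exists _ _ hstep
  refine not_isAbsolutelyMinimumAttaining_of_orthonormal T (z := f)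
    ⟨fun n => (hf n).1, fun m n hmn => ?_⟩ (fun m n hmn => ?_) (ha0.trans hac.le)
    (fun n => (hf n).2) fun d hd => ?_
  · rcases hmn.lt_or_gt with h | h
    · exact (hr m n h).1
    · exact inner_eq_zero_symm.1 (hr n m h).1
  · rcases hmn.lt_or_gt with h | h
    · exact (hr m n h).2.1
    · exact inner_eq_zero_symm.1 (hr n m h).2.1
  · have hgeo (n : ℕ) : ‖T (f n)‖ - c ≤ (‖T (f 0)‖ - c) * (1 / 2) ^ n := by
      induction n with
      | zero => simp
      | succ n ih =>
        have := (hr n (n + 1) n.lt_succ_self).2.2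
        rw [pow_succ]
        linarith
    have htend : Tendsto (fun n : ℕ => (‖T (f 0)‖ - c) * (1 / 2 : ℝ) ^ n) atTop (𝓝 0) := by
      simpa using (tendsto_pow_atTop_nhds_zero_of_lt_one (r := (1 / 2 : ℝ)) (by norm_num)
        (by norm_num)).const_mul (‖T (f 0)‖ - c)
    obtain ⟨n, hn⟩ := (htend.eventually_lt_const (sub_pos.2 hd)).exists
    exact ⟨n, by linarith [hgeo n]⟩

/-! ### Eigenvalues accumulating at the essential point from above -/

/-- Accumulation points of the spectrum belong to the essential spectrum. -/
theorem Set.Infinite.exists_accPt_mem_essentialSpectrum {H : Type*} [NormedAddCommGroup H]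
    [InnerProductSpace ℂ H] [CompleteSpace H] {T : H →L[ℂ] H} {s : Set ℂ} (hs : s.Infinite)
    (hsT : s ⊆ spectrum ℂ T) : ∃ z ∈ essentialSpectrum T, AccPt z (𝓟 s) := by
  obtain ⟨z, hz, hacc⟩ := hs.exists_accPt_of_subset_isCompact (spectrum.isCompact T) hsT
  exact ⟨z, ⟨hz, fun hd => hd.2.2 (hacc.mono (principal_mono.2 hsT))⟩, hacc⟩

theorem mem_spectrum_of_hasEigenvalue {H : Type*} [NormedAddCommGroup H] [InnerProductSpace ℂ H]
    {T : H →L[ℂ] H} {z : ℂ} (hz : Module.End.HasEigenvalue (T : H →ₗ[ℂ] H) z) :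
    z ∈ spectrum ℂ T := by
  obtain ⟨x, hx⟩ := hz.exists_hasEigenvector
  rw [spectrum.mem_iff]
  rintro ⟨u, hu⟩
  have h1 : (u : H →L[ℂ] H) x = 0 := by
    have : T x = z • x := hx.apply_eq_smul
    simp [hu, this, Algebra.algebraMap_eq_smul_one]
  have h2 : (((u⁻¹ : (H →L[ℂ] H)ˣ) : H →L[ℂ] H) * (u : H →L[ℂ] H)) x = 0 := by
    rw [mul_apply_eq_comp, h1, map_zero]
  rw [Units.inv_mul] at h2
  exact hx.2 h2

theorem finite_eigenvalues_of_isAbsolutelyMinimumAttaining {H : Type*} [NormedAddCommGroup H]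
    [InnerProductSpace ℂ H] [CompleteSpace H] {T : H →L[ℂ] H} (hT : IsSelfAdjoint T)
    (hAM : IsAbsolutelyMinimumAttaining T) {b : ℝ} (hb0 : 0 ≤ b)
    (hb : essentialSpectrum T = {(b : ℂ)}) :
    {t : ℝ | b < t ∧ Module.End.HasEigenvalue (T : H →ₗ[ℂ] H) (t : ℂ)}.Finite := by
  by_contra hinf
  set E := {t : ℝ | b < t ∧ Module.End.HasEigenvalue (T : H →ₗ[ℂ] H) (t : ℂ)}
  have hEinf : E.Infinite := hinf
  obtain ⟨z, hz, hacc⟩ := (hEinf.image Complex.ofReal_injective.injOn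
    ).exists_accPt_mem_essentialSpectrum (T := T)
    (by rintro _ ⟨t, ht, rfl⟩; exact mem_spectrum_of_hasEigenvalue ht.2)
  -- The accumulation point is essential, so it is `b`; this makes the norms `‖T (v t)‖ = t` come
  -- arbitrarily close to `b`.
  rw [hb, mem_singleton_iff] at hz
  subst hz
  have hv (t : E) : ∃ x : H, ‖x‖ = 1 ∧ T x = ((t : ℝ) : ℂ) • x := by
    obtain ⟨x, hx⟩ := t.2.2.exists_hasEigenvector
    have hTx : T x = ((t : ℝ) : ℂ) • x := hx.apply_eq_smul
    exact ⟨((‖x‖⁻¹ : ℝ) : ℂ) • x, norm_inv_norm_smul hx.2, by rw [map_smul, hTx, smul_comm]⟩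
  choose v hv1 hvT using hv
  have horth {s t : E} (hst : s ≠ t) : inner ℂ (v s) (v t) = 0 := by
    have h1 : inner ℂ (T (v s)) (v t) = inner ℂ (v s) (T (v t)) := by
      rw [← ContinuousLinearMap.adjoint_inner_right, hT.adjoint_eq]
    rw [hvT, hvT, inner_smul_left, inner_smul_right, Complex.conj_ofReal, ← sub_eq_zero,
      ← sub_mul, mul_eq_zero, sub_eq_zero, Complex.ofReal_inj] at h1
    exact h1.resolve_left fun h => hst (Subtype.ext h)
  have hnorm (t : E) : ‖T (v t)‖ = t := by
    rw [hvT, norm_smul, hv1, Complex.norm_real, mul_one, Real.norm_eq_abs,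
      abs_of_pos (hb0.trans_lt t.2.1)]
  have : Nonempty E := hEinf.nonempty.to_subtype
  refine not_isAbsolutelyMinimumAttaining_of_orthonormal T (z := v) ⟨hv1, fun s t => horth⟩
    (fun s t hst => ?_) hb0 (fun t => by rw [hnorm]; exact t.2.1) (fun d hd => ?_) hAM
  · simp only [hvT, inner_smul_left, inner_smul_right, horth hst, mul_zero]
  · obtain ⟨_, ⟨h1, t, ht, rfl⟩, -⟩ :=
      accPt_iff_nhds.1 hacc _ (Metric.ball_mem_nhds _ (sub_pos.2 hd))
    refine ⟨⟨t, ht⟩, ?_⟩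
    rw [hnorm]
    rw [Metric.mem_ball, dist_eq_norm, ← Complex.ofReal_sub, Complex.norm_real] at h1
    have := (abs_lt.1 h1).2
    simp only
    linarith

/-! ### Finite-rank and compact functions of a self-adjoint operator -/

theorem finiteDimensional_ker_mul {R E : Type*} [Field R] [AddCommGroup E] [Module R E]
    (A B : Module.End R E) [FiniteDimensional R (LinearMap.ker A)]
    [FiniteDimensional R (LinearMap.ker B)] : FiniteDimensional R (LinearMap.ker (A * B)) := by
  have h : LinearMap.ker (A * B) = (LinearMap.ker A).comap B := LinearMap.ker_comp B A
  rw [h]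
  let f : (LinearMap.ker A).comap B →ₗ[R] LinearMap.ker A :=
    B.restrict fun x hx => hx
  have hk : FiniteDimensional R (LinearMap.ker f) := by
    refine FiniteDimensional.of_injective
      ((((LinearMap.ker A).comap B).subtype.comp (LinearMap.ker f).subtype).codRestrict
        (LinearMap.ker B) fun x => ?_) ?_
    · exact congrArg Subtype.val (LinearMap.mem_ker.1 x.2)
    · intro x y hxy
      have hxy' := congrArg Subtype.val hxy
      exact Subtype.ext (Subtype.ext hxy')
  have hq := Module.Finite.equiv f.quotKerEquivRange.symm
  exact Module.Finite.of_submodule_quotient (LinearMap.ker f)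

/-- A function of a self-adjoint operator supported on finitely many eigenvalues of finite
multiplicity has finite rank. -/
theorem IsSelfAdjoint.finiteDimensional_range_cfc {H : Type*} [NormedAddCommGroup H]
    [InnerProductSpace ℂ H] [CompleteSpace H] {T : H →L[ℂ] H} (hT : IsSelfAdjoint T) {f : ℝ → ℝ}
    (hf : Continuous f) (hfin : {t ∈ spectrum ℝ T | f t ≠ 0}.Finite)
    (hmult : ∀ t ∈ spectrum ℝ T, f t ≠ 0 →
      FiniteDimensional ℂ (Module.End.eigenspace (T : H →ₗ[ℂ] H) (t : ℂ))) :
    FiniteDimensional ℂ (cfc f T).range := by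
  set s := hfin.toFinset
  let p (u : Finset ℝ) : Polynomial ℝ := ∏ t ∈ u, (Polynomial.X - Polynomial.C t)
  have hker (u : Finset ℝ) (hu : u ⊆ s) : FiniteDimensional ℂ (Polynomial.aeval T (p u)).ker := by
    induction u using Finset.induction_on with
    | empty =>
      have : (Polynomial.aeval T (p ∅)).ker = ⊥ := by
        rw [Submodule.eq_bot_iff]
        intro x hx
        simpa [p] using hx
      rw [this]
      infer_instance
    | insert t u ht ih =>
      have h1 := ih ((Finset.subset_insert _ _).trans hu)
      have hts := (hfin.mem_toFinset).1 (hu (Finset.mem_insert_self t u))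
      have h2 : FiniteDimensional ℂ (T - algebraMap ℝ (H →L[ℂ] H) t).ker := by
        have h3 := hmult t hts.1 hts.2
        have h4 : (T - algebraMap ℝ (H →L[ℂ] H) t).ker =
            Module.End.eigenspace (T : H →ₗ[ℂ] H) (t : ℂ) := by
          ext x
          simp [Algebra.algebraMap_eq_smul_one, sub_eq_zero]
        rwa [h4]
      have h5 : Polynomial.aeval T (p (insert t u)) =
          (T - algebraMap ℝ (H →L[ℂ] H) t) * Polynomial.aeval T (p u) := by
        simp [p, Finset.prod_insert ht]
      rw [h5]
      exact finiteDimensional_ker_mul ((T - algebraMap ℝ (H →L[ℂ] H) t : H →L[ℂ] H) : H →ₗ[ℂ] H)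
        ((Polynomial.aeval T (p u) : H →L[ℂ] H) : H →ₗ[ℂ] H)
  -- The roots of `p s` are the spectral points where `f` is nonzero, so the range of `cfc f T` lies
  -- in the finite-dimensional kernel of `p s` at `T`.
  have hzero : Polynomial.aeval T (p s) * cfc f T = 0 := by
    rw [← cfc_polynomial (p s) T hT, ← cfc_mul _ _ T (by fun_prop) hf.continuousOn,
      ← cfc_zero ℝ T]
    refine cfc_congr fun t ht => ?_
    by_cases h0 : f t = 0
    · simp [h0]
    · have : t ∈ s := hfin.mem_toFinset.2 ⟨ht, h0⟩
      simp [p, Polynomial.eval_prod, Finset.prod_eq_zero this]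
  have := hker s subset_rfl
  refine Submodule.finiteDimensional_of_le (S₂ := (Polynomial.aeval T (p s)).ker) ?_
  rintro _ ⟨x, rfl⟩
  exact DFunLike.congr_fun hzero x

theorem mem_discreteSpectrum_of_notMem_essentialSpectrum {H : Type*} [NormedAddCommGroup H]
    [InnerProductSpace ℂ H] [CompleteSpace H] {T : H →L[ℂ] H} {t : ℝ} (ht : t ∈ spectrum ℝ T)
    (hess : (t : ℂ) ∉ essentialSpectrum T) : (t : ℂ) ∈ discreteSpectrum T := by
  by_contra h
  exact hess ⟨spectrum.algebraMap_mem ℂ ht, h⟩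

theorem finite_inter_spectrum_of_isClosed {H : Type*} [NormedAddCommGroup H]
    [InnerProductSpace ℂ H] [CompleteSpace H] {T : H →L[ℂ] H} {s : Set ℝ} (hs : IsClosed s)
    (hess : ∀ t ∈ s, (t : ℂ) ∉ essentialSpectrum T) : (s ∩ spectrum ℝ T).Finite := by
  by_contra hinf
  have hinf' : (s ∩ spectrum ℝ T).Infinite := hinf
  obtain ⟨z, hz, hacc⟩ := (hinf'.image Complex.ofReal_injective.injOn
    ).exists_accPt_mem_essentialSpectrum (T := T)
    (by rintro _ ⟨t, ht, rfl⟩; exact spectrum.algebraMap_mem ℂ ht.2)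
  have hcl : IsClosed (Complex.ofReal '' s) :=
    Complex.isometry_ofReal.isClosedEmbedding.isClosedMap _ hs
  have hz' : z ∈ Complex.ofReal '' s :=
    hcl.closure_subset_iff.2 (image_mono inter_subset_left) hacc.clusterPt.mem_closure
  obtain ⟨t, ht, rfl⟩ := hz'
  exact hess t ht hz

/-- Otherwise the spectrum is finite with finite multiplicities, and the constant function 1 shows
that the identity has finite rank. -/
theorem essentialSpectrum_nonempty {H : Type*} [NormedAddCommGroup H] [InnerProductSpace ℂ H]
    [CompleteSpace H] (hH : ¬ FiniteDimensional ℂ H) {T : H →L[ℂ] H} (hT : IsSelfAdjoint T) :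
    (essentialSpectrum T).Nonempty := by
  by_contra hempty
  rw [not_nonempty_iff_eq_empty] at hempty
  have hfin := finite_inter_spectrum_of_isClosed (T := T) isClosed_univ (by simp [hempty])
  rw [univ_inter] at hfin
  have h1 := hT.finiteDimensional_range_cfc (f := fun _ => 1) continuous_const
    (hfin.subset (sep_subset _ _)) fun t ht _ =>
      (mem_discreteSpectrum_of_notMem_essentialSpectrum ht (by simp [hempty])).2.1
  rw [cfc_const_one ℝ T] at h1
  rw [LinearMap.range_eq_top.2 fun x => ⟨x, rfl⟩] at h1
  exact hH (Module.finite_def.2 ((Submodule.fg_iff_finiteDimensional _).2 h1))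

theorem ContinuousLinearMap.isCompactOperator_of_finiteDimensional_range {E F : Type*}
    [NormedAddCommGroup E] [NormedSpace ℂ E] [NormedAddCommGroup F] [NormedSpace ℂ F]
    (A : E →L[ℂ] F) [FiniteDimensional ℂ A.range] : IsCompactOperator A := by
  have : ProperSpace A.range := FiniteDimensional.proper ℂ _
  have h1 : IsCompactOperator (A.codRestrict A.range fun x => ⟨x, rfl⟩) :=
    isCompactOperator_of_locallyCompactSpace_dom _
  exact h1.clm_comp A.range.subtypeL

/-- A function of a self-adjoint operator vanishing on the essential spectrum is compact. -/
theorem IsSelfAdjoint.isCompactOperator_cfc {H : Type*} [NormedAddCommGroup H]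
    [InnerProductSpace ℂ H] [CompleteSpace H] {T : H →L[ℂ] H} (hT : IsSelfAdjoint T) {f : ℝ → ℝ}
    (hf : Continuous f) (hess : ∀ t : ℝ, (t : ℂ) ∈ essentialSpectrum T → f t = 0) :
    IsCompactOperator (cfc f T : H →L[ℂ] H) := by
  -- the soft threshold of `f` at level `ε`
  let g (ε t : ℝ) : ℝ := f t - max (-ε) (min ε (f t))
  have hg (ε : ℝ) : Continuous (g ε) := by fun_prop
  have hg0 {ε t : ℝ} (hε : 0 < ε) (ht : g ε t ≠ 0) : ε ≤ |f t| := by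
    by_contra! h
    have h1 := abs_lt.1 h
    exact ht (by simp [g, min_eq_right h1.2.le, max_eq_right h1.1.le])
  have hcompact {ε : ℝ} (hε : 0 < ε) : IsCompactOperator (cfc (g ε) T : H →L[ℂ] H) := by
    -- The closed set `{t | ε ≤ |f t|}` misses the essential spectrum, so it holds only finitely
    -- many spectral points, all discrete.
    have hnot (t : ℝ) (ht : ε ≤ |f t|) : (t : ℂ) ∉ essentialSpectrum T := fun h => by
      rw [hess t h, abs_zero] at ht
      linarith
    have := hT.finiteDimensional_range_cfc (hg ε)
      ((finite_inter_spectrum_of_isClosed (T := T) (s := {t | ε ≤ |f t|})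
        (isClosed_le continuous_const hf.abs) hnot).subset fun t ht => ⟨hg0 hε ht.2, ht.1⟩)
      fun t ht h0 => (mem_discreteSpectrum_of_notMem_essentialSpectrum ht
        (hnot t (hg0 hε h0))).2.1
    exact (cfc (g ε) T).isCompactOperator_of_finiteDimensional_range
  have hdist {ε : ℝ} (hε : 0 < ε) : ‖cfc (g ε) T - cfc f T‖ ≤ ε := by
    rw [← cfc_sub _ _ T (hg ε).continuousOn hf.continuousOn]
    refine norm_cfc_le hε.le fun t _ => ?_
    simp only [g, sub_sub_cancel_left, norm_neg, Real.norm_eq_abs]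
    exact abs_le.2 ⟨le_max_left _ _, max_le (by linarith) (min_le_left _ _)⟩
  refine isCompactOperator_of_tendsto (l := 𝓝[>] (0 : ℝ)) (F := fun ε => cfc (g ε) T) ?_ ?_
  · rw [tendsto_iff_norm_sub_tendsto_zero]
    refine squeeze_zero' (Eventually.of_forall fun _ => norm_nonneg _) ?_
      (tendsto_id.mono_left nhdsWithin_le_nhds)
    filter_upwards [self_mem_nhdsWithin] with ε hε using hdist hε
  · filter_upwards [self_mem_nhdsWithin] with ε hε using hcompact hε

/-! ### Attainment when the essential spectrum is one point -/

theorem minimumModulus_nonneg {E F : Type*} [NormedAddCommGroup E] [NormedSpace ℂ E]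
    [NormedAddCommGroup F] [NormedSpace ℂ F] (T : E →L[ℂ] F) : 0 ≤ minimumModulus T :=
  Real.sInf_nonneg (by rintro _ ⟨x, -, rfl⟩; exact norm_nonneg _)

theorem minimumModulus_mul_norm_le {E F : Type*} [NormedAddCommGroup E] [NormedSpace ℂ E]
    [NormedAddCommGroup F] [NormedSpace ℂ F] (T : E →L[ℂ] F) (x : E) :
    minimumModulus T * ‖x‖ ≤ ‖T x‖ := by
  rcases eq_or_ne x 0 with rfl | hx
  · simp
  have h1 := minimumModulus_le T (norm_inv_norm_smul hx)
  rwa [map_smul, norm_smul, Complex.norm_real, norm_inv, norm_norm, ← div_eq_inv_mul,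
    le_div_iff₀ (norm_pos_iff.2 hx)] at h1

theorem isMinimumAttaining_of_norm_apply_le {E F : Type*} [NormedAddCommGroup E]
    [NormedSpace ℂ E] [NormedAddCommGroup F] [NormedSpace ℂ F] (T : E →L[ℂ] F) {x : E}
    (hx : x ≠ 0) (h : ‖T x‖ ≤ minimumModulus T * ‖x‖) : IsMinimumAttaining T := by
  refine ⟨((‖x‖⁻¹ : ℝ) : ℂ) • x, norm_inv_norm_smul hx, ?_⟩
  rw [map_smul, norm_smul, Complex.norm_real, norm_inv, norm_norm,
    h.antisymm (minimumModulus_mul_norm_le T x), mul_comm,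
    mul_inv_cancel_right₀ (norm_ne_zero_iff.2 hx)]

theorem isMinimumAttaining_of_finiteDimensional {E F : Type*} [NormedAddCommGroup E]
    [NormedSpace ℂ E] [Nontrivial E] [FiniteDimensional ℂ E] [NormedAddCommGroup F]
    [NormedSpace ℂ F] (T : E →L[ℂ] F) : IsMinimumAttaining T := by
  have : ProperSpace E := FiniteDimensional.proper ℂ E
  obtain ⟨y, hy⟩ := exists_ne (0 : E)
  obtain ⟨x, hx, hmin⟩ := (isCompact_sphere (0 : E) 1).exists_isMinOn
    ⟨_, by simpa using norm_inv_norm_smul hy⟩ (f := fun x => ‖T x‖) (by fun_prop)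
  have hx1 : ‖x‖ = 1 := by simpa using hx
  refine ⟨x, hx1, le_antisymm (le_csInf ⟨_, x, hx1, rfl⟩ ?_) (minimumModulus_le T hx1)⟩
  rintro _ ⟨z, hz, rfl⟩
  exact hmin (by simpa using hz)

/-- Factor `A` through its square root. This turns a lower bound on `‖A x‖` into one on the
quadratic form. -/
theorem ContinuousLinearMap.IsPositive.exists_norm_apply_sq_le {E : Type*} [NormedAddCommGroup E]
    [InnerProductSpace ℂ E] [CompleteSpace E] {A : E →L[ℂ] E} (hA : A.IsPositive) :
    ∃ C > 0, ∀ x, ‖A x‖ ^ 2 ≤ C * (inner ℂ (A x) x).re := by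
  have hA0 : 0 ≤ A := (ContinuousLinearMap.nonneg_iff_isPositive A).2 hA
  set R := CFC.sqrt A
  have hRR : R * R = A := CFC.sqrt_mul_sqrt_self A hA0
  have hR : IsSelfAdjoint R := (CFC.sqrt_nonneg A).isSelfAdjoint
  refine ⟨‖R‖ ^ 2 + 1, by positivity, fun x => ?_⟩
  have hx : A x = R (R x) := by rw [← hRR, mul_apply_eq_comp]
  have h1 : (inner ℂ (A x) x).re = ‖R x‖ ^ 2 := by
    have h2 := inner_self_eq_norm_sq (𝕜 := ℂ) (R x)
    rwa [← ContinuousLinearMap.adjoint_inner_left, hR.adjoint_eq, ← hx] at h2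
  rw [h1, hx]
  calc ‖R (R x)‖ ^ 2 ≤ (‖R‖ * ‖R x‖) ^ 2 :=
        pow_le_pow_left₀ (norm_nonneg _) (R.le_opNorm _) 2
    _ = ‖R‖ ^ 2 * ‖R x‖ ^ 2 := mul_pow _ _ _
    _ ≤ (‖R‖ ^ 2 + 1) * ‖R x‖ ^ 2 := by gcongr; linarith

/-- If `S† S` is a compact perturbation of `b ^ 2` and the minimum modulus of `S` is below `b`,
then it is attained. -/
theorem isMinimumAttaining_of_minimumModulus_lt {E F : Type*} [NormedAddCommGroup E]
    [InnerProductSpace ℂ E] [CompleteSpace E] [Nontrivial E] [NormedAddCommGroup F]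
    [InnerProductSpace ℂ F] [CompleteSpace F] (S : E →L[ℂ] F) {b : ℝ}
    (hb : minimumModulus S < b) {K : E →L[ℂ] E} (hK : IsCompactOperator K)
    (hS : ∀ x, ContinuousLinearMap.adjoint S (S x) = ((b ^ 2 : ℝ) : ℂ) • x + K x) :
    IsMinimumAttaining S := by
  set m := minimumModulus S with hm
  have hm0 : 0 ≤ m := minimumModulus_nonneg S
  set μ : ℂ := ((m ^ 2 - b ^ 2 : ℝ) : ℂ) with hμdef
  have hμ : μ ≠ 0 := by
    rw [hμdef, Complex.ofReal_ne_zero]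
    nlinarith
  have hquad (x : E) : inner ℂ ((K - μ • (1 : E →L[ℂ] E)) x) x =
      ((‖S x‖ ^ 2 - m ^ 2 * ‖x‖ ^ 2 : ℝ) : ℂ) := by
    have h1 : (K - μ • (1 : E →L[ℂ] E)) x =
        ContinuousLinearMap.adjoint S (S x) - ((m ^ 2 : ℝ) : ℂ) • x := by
      rw [hS, hμdef]
      simp [sub_smul]
      abel
    rw [h1, inner_sub_left, ContinuousLinearMap.adjoint_inner_left, inner_smul_left,
      Complex.conj_ofReal, inner_self_eq_norm_sq_to_K, inner_self_eq_norm_sq_to_K]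
    simp
  by_cases heig : Module.End.HasEigenvalue (K : E →ₗ[ℂ] E) μ
  · obtain ⟨x, hx⟩ := heig.exists_hasEigenvector
    refine isMinimumAttaining_of_norm_apply_le S hx.2 ?_
    have h1 : (K - μ • (1 : E →L[ℂ] E)) x = 0 := by
      have : K x = μ • x := hx.apply_eq_smul
      simp [this]
    have h2 := hquad x
    rw [h1, inner_zero_left, eq_comm, Complex.ofReal_eq_zero, sub_eq_zero, ← mul_pow] at h2
    exact le_of_sq_le_sq h2.le (by positivity)
  -- By the Fredholm alternative `K - μ` is bounded below. Being positive, it then has form at least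
  -- `δ ^ 2 / C` on unit vectors, which pushes the infimum of `‖S x‖` above `m`.
  · exfalso
    obtain ⟨δ, hδ, hbelow⟩ := antilipschitzWith_iff_exists_mul_le_norm.1
      (hK.antilipschitz_of_not_hasEigenvalue hμ heig)
    have hpos : (K - μ • (1 : E →L[ℂ] E)).IsPositive := by
      rw [ContinuousLinearMap.isPositive_iff_complex]
      intro x
      simp only [hquad, RCLike.re_eq_complex_re, Complex.ofReal_re, true_and, sub_nonneg]
      rw [← mul_pow]
      exact pow_le_pow_left₀ (by positivity) (minimumModulus_mul_norm_le S x) 2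
    obtain ⟨C, hC, hCS⟩ := hpos.exists_norm_apply_sq_le
    have hlt : m < √(m ^ 2 + δ ^ 2 / C) :=
      Real.lt_sqrt_of_sq_lt (by linarith [show 0 < δ ^ 2 / C by positivity])
    obtain ⟨y, hy⟩ := exists_ne (0 : E)
    obtain ⟨_, ⟨x, hx, rfl⟩, hxlt⟩ := exists_lt_of_csInf_lt
      (⟨_, _, norm_inv_norm_smul hy, rfl⟩ : {r : ℝ | ∃ x : E, ‖x‖ = 1 ∧ r = ‖S x‖}.Nonempty) hlt
    rw [Real.lt_sqrt (norm_nonneg _)] at hxlt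
    have h1 := pow_le_pow_left₀ (by positivity) (hbelow x) 2
    have h2 := hCS x
    rw [hquad, Complex.ofReal_re, hx] at h2
    rw [hx] at h1
    have h3 : ‖S x‖ ^ 2 - m ^ 2 < δ ^ 2 / C := by linarith
    rw [lt_div_iff₀ hC] at h3
    linarith

theorem isAbsolutelyMinimumAttaining_of_essentialSpectrum_eq_singleton {H : Type*}
    [NormedAddCommGroup H] [InnerProductSpace ℂ H] [CompleteSpace H] {T : H →L[ℂ] H}
    (hT : T.IsPositive) {b : ℝ} (hb0 : 0 ≤ b) (hess : essentialSpectrum T = {(b : ℂ)})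
    (hfin : {t : ℝ | b < t ∧ Module.End.HasEigenvalue (T : H →ₗ[ℂ] H) (t : ℂ)}.Finite) :
    IsAbsolutelyMinimumAttaining T := by
  intro M hM hMbot
  have : CompleteSpace M := hM.completeSpace_coe
  have : Nontrivial M := Submodule.nontrivial_iff_ne_bot.2 hMbot
  have hsa : IsSelfAdjoint T := hT.isSelfAdjoint
  by_cases hMfin : FiniteDimensional ℂ M
  · exact isMinimumAttaining_of_finiteDimensional _
  have hnonneg (t : ℝ) (ht : t ∈ spectrum ℝ T) : 0 ≤ t :=
    spectrum_nonneg_of_nonneg ((ContinuousLinearMap.nonneg_iff_isPositive T).2 hT) ht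
  let f (t : ℝ) : ℝ := t ^ 2 - b ^ 2
  let g (t : ℝ) : ℝ := max (f t) 0
  have hf : Continuous f := by fun_prop
  have hg : Continuous g := by fun_prop
  have hcfcf (x : H) : cfc f T x = T (T x) - ((b ^ 2 : ℝ) : ℂ) • x := by
    rw [cfc_sub (fun t : ℝ => t ^ 2) (fun _ => b ^ 2) T, cfc_pow_id T 2, cfc_const (b ^ 2) T]
    simp only [sq, Algebra.algebraMap_eq_smul_one, sub_apply, mul_apply_eq_comp,
      smul_apply, one_apply_eq_self, Complex.coe_smul]
  have hnormT (x : H) : ‖T x‖ ^ 2 = b ^ 2 * ‖x‖ ^ 2 + (inner ℂ (cfc f T x) x).re := by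
    have h2 := inner_self_eq_norm_sq (𝕜 := ℂ) (T x)
    have h3 := inner_self_eq_norm_sq (𝕜 := ℂ) x
    have h4 : (inner ℂ (T (T x)) x).re = ‖T x‖ ^ 2 := by
      rw [← h2, ← ContinuousLinearMap.adjoint_inner_left, hsa.adjoint_eq]
      rfl
    have h5 : (inner ℂ x x).re = ‖x‖ ^ 2 := h3
    rw [hcfcf, inner_sub_left, inner_smul_left, Complex.conj_ofReal, Complex.sub_re,
      Complex.re_ofReal_mul, h4, h5]
    ring
  rcases lt_or_ge (minimumModulus (T.comp M.subtypeL)) b with hlt | hge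
  · have hcomp : IsCompactOperator (cfc f T : H →L[ℂ] H) :=
      hsa.isCompactOperator_cfc hf fun t ht => by
        rw [hess, mem_singleton_iff, Complex.ofReal_inj] at ht
        simp [f, ht]
    let K : M →L[ℂ] M :=
      (ContinuousLinearMap.adjoint M.subtypeL).comp ((cfc f T).comp M.subtypeL)
    have hK : IsCompactOperator K :=
      (hcomp.comp_clm M.subtypeL).clm_comp (ContinuousLinearMap.adjoint M.subtypeL)
    refine isMinimumAttaining_of_minimumModulus_lt _ hlt hK fun x => ?_
    refine ext_inner_right ℂ fun y => ?_
    rw [ContinuousLinearMap.adjoint_inner_left, inner_add_left]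
    simp only [K, ContinuousLinearMap.comp_apply]
    rw [ContinuousLinearMap.adjoint_inner_left, hcfcf, inner_sub_left,
      ← ContinuousLinearMap.adjoint_inner_left T, hsa.adjoint_eq, inner_smul_left, inner_smul_left]
    simp
  · have hsupp (t : ℝ) (ht : t ∈ spectrum ℝ T) (h0 : g t ≠ 0) :
        b < t ∧ (t : ℂ) ∈ discreteSpectrum T := by
      have hbt : b < t := by
        by_contra! h
        exact h0 (max_eq_right (sub_nonpos.2 (pow_le_pow_left₀ (hnonneg t ht) h 2)))
      refine ⟨hbt, mem_discreteSpectrum_of_notMem_essentialSpectrum ht ?_⟩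
      rw [hess, mem_singleton_iff, Complex.ofReal_inj]
      exact hbt.ne'
    have hrange : FiniteDimensional ℂ (cfc g T).range :=
      hsa.finiteDimensional_range_cfc hg
        (hfin.subset fun t ht => ⟨(hsupp t ht.1 ht.2).1, (hsupp t ht.1 ht.2).2.1⟩)
        fun t ht h0 => (hsupp t ht h0).2.2.1
    -- A finite-rank operator cannot be injective on the infinite-dimensional `M`.
    obtain ⟨x, hx0, hx⟩ : ∃ x : M, x ≠ 0 ∧ cfc g T (x : H) = 0 := by
      by_contra! hcon
      refine hMfin (FiniteDimensional.of_injective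
        (((cfc g T : H →L[ℂ] H) : H →ₗ[ℂ] H).rangeRestrict.comp M.subtype) ?_)
      rw [injective_iff_map_eq_zero]
      intro x hx
      by_contra h0
      exact hcon x h0 (congrArg Subtype.val hx)
    refine isMinimumAttaining_of_norm_apply_le _ hx0 ?_
    have hle : cfc f T ≤ cfc g T :=
      cfc_mono (fun t _ => le_max_left _ _) hf.continuousOn hg.continuousOn
    have h1 := ((ContinuousLinearMap.le_def _ _).1 hle).re_inner_nonneg_left (x : H)
    rw [sub_apply, hx, zero_sub, inner_neg_left, map_neg] at h1
    have h2 : (inner ℂ (cfc f T (x : H)) (x : H)).re ≤ 0 := by simpa using h1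
    have h3 : ‖T x‖ ≤ b * ‖(x : H)‖ := by
      refine le_of_sq_le_sq ?_ (by positivity)
      rw [hnormT, mul_pow]
      linarith
    exact h3.trans (mul_le_mul_of_nonneg_right hge (norm_nonneg _))

/-! ### The characterization -/

theorem theorem3p9 {H : Type*} [NormedAddCommGroup H] [InnerProductSpace ℂ H] [CompleteSpace H]
    (hH : ¬ FiniteDimensional ℂ H) (T : H →L[ℂ] H) (hT : T.IsPositive) :
    IsAbsolutelyMinimumAttaining T ↔
      (∃ b : ℂ, essentialSpectrum T = {b}) ∧
      {t : ℝ | t ∈ Set.Ioc (essentialMinimumModulus T) ‖T‖ ∧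
        Module.End.HasEigenvalue (T : H →ₗ[ℂ] H) (t : ℂ)}.Finite := by
  have hsa : IsSelfAdjoint T := hT.isSelfAdjoint
  have hreal (z : ℂ) (hz : z ∈ essentialSpectrum T) : ∃ t : ℝ, 0 ≤ t ∧ z = t := by
    have hre : z = (z.re : ℂ) := hsa.mem_spectrum_eq_re hz.1
    refine ⟨z.re, ?_, hre⟩
    refine spectrum_nonneg_of_nonneg ((ContinuousLinearMap.nonneg_iff_isPositive T).2 hT)
      (spectrum.of_algebraMap_mem ℂ ?_)
    exact hre ▸ hz.1
  have hme {b : ℝ} (hb0 : 0 ≤ b) (hb : essentialSpectrum T = {(b : ℂ)}) :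
      essentialMinimumModulus T = b := by
    simp [essentialMinimumModulus, hb, abs_of_nonneg hb0]
  constructor
  · intro hAM
    obtain ⟨z, hz⟩ := essentialSpectrum_nonempty hH hsa
    obtain ⟨b, hb0, rfl⟩ := hreal z hz
    have hsingle : essentialSpectrum T = {(b : ℂ)} := by
      refine Subset.antisymm (fun w hw => ?_) (singleton_subset_iff.2 hz)
      obtain ⟨a, ha0, rfl⟩ := hreal w hw
      rcases lt_trichotomy a b with h | h | h
      · exact absurd hAM (not_isAbsolutelyMinimumAttaining_of_lt hH hsa ha0 h hw hz)
      · rw [h]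
        rfl
      · exact absurd hAM (not_isAbsolutelyMinimumAttaining_of_lt hH hsa hb0 h hz hw)
    refine ⟨⟨b, hsingle⟩, ?_⟩
    rw [hme hb0 hsingle]
    exact (finite_eigenvalues_of_isAbsolutelyMinimumAttaining hsa hAM hb0 hsingle).subset
      fun t ht => ⟨ht.1.1, ht.2⟩
  · rintro ⟨⟨z, hz⟩, hfin⟩
    obtain ⟨b, hb0, rfl⟩ := hreal z (hz ▸ mem_singleton z)
    rw [hme hb0 hz] at hfin
    refine isAbsolutelyMinimumAttaining_of_essentialSpectrum_eq_singleton hT hb0 hz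
      (hfin.subset fun t ht => ⟨⟨ht.1, ?_⟩, ht.2⟩)
    -- Eigenvalues never exceed `‖T‖`, so the upper end of the interval excludes none.
    have h1 : ‖(t : ℂ)‖ ≤ ‖T‖ * ‖(1 : H →L[ℂ] H)‖ :=
      spectrum.norm_le_norm_mul_of_mem (mem_spectrum_of_hasEigenvalue ht.2)
    have h2 : ‖(t : ℂ)‖ ≤ ‖T‖ :=
      h1.trans (mul_le_of_le_one_right (norm_nonneg _) ContinuousLinearMap.norm_id_le)
    rw [Complex.norm_real] at h2
    exact (le_abs_self t).trans h2
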